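/- Let $\mathbb T$ be the unit circle with normalized arclength measure $\mu$, let $\chi(z)=z$ on $\mathbb T$, and let $H^2\subset L^2(\mathbb T)$ be the classical Hardy space (the functions whose Fourier coefficients of negative index vanish). Let $\phi\in L^\infty(\mathbb T)$ be real-valued. For a linear subspace $\mathcal V\subset\mathbb C\oplus\mathbb C z$ put $H^2_{\mathcal V}=H^2\ominus\mathcal V$, let $P_{\mathcal V}$ be the orthogonal projection of $L^2(\mathbb T)$ onto $H^2_{\mathcal V}$, and define the Toeplitz operator $T_\phi^{\mathcal V}f=P_{\mathcal V}(\phi f)$ on $H^2_{\mathcal V}$. A real number $\lambda$ is an eigenvalue of $\phi$ relative to the Neil algebra $\mathcal A$ (the functions $f$ in the disc algebra with $f'(0)=0$), with eigenvector $g$, if there is a subspace $\mathcal V\subset\mathbb C\oplus\mathbb C z$ such that $0\ne g\in H^2_{\mathcal V}$ and $T_\phi^{\mathcal V}g=\lambda g$. A function $g\in H^2$ is outer if $\{pg: p \text{ a polynomial in } z\}$ is dense in $H^2$. Suppose that there are $c\in\mathbb C$ and real numbers $m,M$ such that \[ \operatorname{ess\,sup}\{\phi(z): cz+(cz)^*<0\}=m<0<M=\operatorname{ess\,inf}\{\phi(z):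 cz+(cz)^*>0\}. \] Then: 1. Each $\lambda\in(m,M)$ is an eigenvalue of $\phi$ relative to $\mathcal A$. Further, for each such $\lambda$ there is an outer function $f_\lambda\in H^2$, unique up to multiplication by a unimodular constant, such that \[ (\phi-\lambda)|f_\lambda|^2=c\chi+(c\chi)^*\quad\text{a.e. on }\mathbb T \] (with the given $c$, independent of $\lambda$), and $f_\lambda$ is an eigenvector of $\phi$ relative to $\mathcal A$ for the eigenvalue $\lambda$. 2. $M$ is an eigenvalue of $\phi$ relative to $\mathcal A$ if and only if $\dfrac{c\chi+(c\chi)^*}{\phi-M}\in L^1(\mathbb T)$, and $m$ is an eigenvalue of $\phi$ relative to $\mathcal A$ if and only if $\dfrac{c\chi+(c\chi)^*}{\phi-m}\in L^1(\mathbb T)$. Here a quotient counts as being in $L^1$ only if its denominator is nonzero almost everywhere. -/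

import Mathlib

open MeasureTheory AddCircle

noncomputable section

namespace NeilToeplitz

instance instTwoPiPos : Fact (0 < 2 * Real.pi) := ⟨Real.two_pi_pos⟩

/-- The unit circle `𝕋`, parametrised by the angle `t` through `t ↦ e^{it}`.  The function
`χ(z) = z` on `𝕋` is Mathlib's `fourier 1`, and `χ ^ n` is `fourier n`. -/
abbrev Circ : Type := AddCircle (2 * Real.pi)

/-- Normalised arclength measure on `𝕋`. -/
abbrev arc : Measure Circ := haarAddCircle

/-- The complex Hilbert space `L²(𝕋)`. -/
abbrev L2 : Type := Lp ℂ 2 arc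

/-- The real-valued symbols: the real space `L^∞(𝕋)`. -/
abbrev Symbol : Type := Lp ℝ ⊤ arc

theorem fourierCoeff_eq_inner (f : L2) (n : ℤ) :
    fourierCoeff (f : Circ → ℂ) n = inner ℂ (fourierLp (T := 2 * Real.pi) 2 n) f := by
  rw [← fourierBasis_repr, HilbertBasis.repr_apply_apply, coe_fourierBasis]

/-- The Hardy space `H²`, as the space of boundary functions: those `f ∈ L²(𝕋)` whose Fourier
coefficients of negative index vanish. -/
def hardy : Submodule ℂ L2 where
  carrier := {f | ∀ n : ℤ, n < 0 → fourierCoeff (f : Circ → ℂ) n = 0}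
  zero_mem' := fun n _ => by rw [fourierCoeff_eq_inner, inner_zero_right]
  add_mem' := fun {f g} hf hg n hn => by
    rw [fourierCoeff_eq_inner, inner_add_right, ← fourierCoeff_eq_inner,
      ← fourierCoeff_eq_inner, hf n hn, hg n hn, add_zero]
  smul_mem' := fun a f hf n hn => by
    rw [fourierCoeff_eq_inner, inner_smul_right, ← fourierCoeff_eq_inner, hf n hn, mul_zero]

theorem mem_hardy {f : L2} :
    f ∈ hardy ↔ ∀ n : ℤ, n < 0 → fourierCoeff (f : Circ → ℂ) n = 0 := Iff.rfl

theorem isClosed_hardy : IsClosed (hardy : Set L2) := by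
  have h : (hardy : Set L2) =
      ⋂ n : ℤ, ⋂ _ : n < 0, {f : L2 | inner ℂ (fourierLp (T := 2 * Real.pi) 2 n) f = 0} := by
    ext f
    simp only [SetLike.mem_coe, mem_hardy, fourierCoeff_eq_inner, Set.mem_iInter,
      Set.mem_ofPred_eq]
  rw [h]
  exact isClosed_iInter fun n => isClosed_iInter fun _ =>
    isClosed_eq (continuous_const.inner continuous_id) continuous_const

/-- The two-dimensional space `ℂ ⊕ ℂ z ⊆ H²`. -/
def lowDegree : Submodule ℂ L2 :=
  Submodule.span ℂ {fourierLp (T := 2 * Real.pi) 2 0, fourierLp (T := 2 * Real.pi) 2 1}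

/-- `H²_𝒱 = H² ⊖ 𝒱`. -/
def hardySub (V : Submodule ℂ L2) : Submodule ℂ L2 := hardy ⊓ Vᗮ

theorem isClosed_hardySub (V : Submodule ℂ L2) : IsClosed (hardySub V : Set L2) :=
  isClosed_hardy.inter V.isClosed_orthogonal

instance (V : Submodule ℂ L2) : CompleteSpace (hardySub V) :=
  (isClosed_hardySub V).completeSpace_coe

/-- The bounded operator `f ↦ φ f` on `L²(𝕋)`, for a real symbol `φ ∈ L^∞(𝕋)`. -/
def mulSymbol (φ : Symbol) : L2 →L[ℂ] L2 :=
  LinearMap.mkContinuous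
    { toFun := fun f => (φ • f : L2)
      map_add' := fun f g => Lp.add_smul φ f g
      map_smul' := fun a f => by
        refine Lp.ext ?_
        filter_upwards [Lp.coeFn_lpSMul (r := 2) φ (a • f), Lp.coeFn_smul a f,
          Lp.coeFn_lpSMul (r := 2) φ f, Lp.coeFn_smul a (φ • f : L2)] with x h1 h2 h3 h4
        rw [h1, RingHom.id_apply, h4, Pi.smul_apply', h2, Pi.smul_apply, Pi.smul_apply, h3,
          Pi.smul_apply', smul_comm] }
    ‖φ‖ (fun f => Lp.norm_smul_le φ f)

/-- `mulSymbol φ` is pointwise multiplication by `φ`. -/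
theorem mulSymbol_coe (φ : Symbol) (f : L2) :
    (mulSymbol φ f : Circ → ℂ) =ᵐ[arc] fun x => (φ x : ℂ) * f x := by
  filter_upwards [Lp.coeFn_lpSMul (r := 2) φ f] with x hx
  exact hx

/-- The Toeplitz operator `T_φ^𝒱 f = P_𝒱 (φ f)` on `H²_𝒱`, where `P_𝒱` is the orthogonal
projection of `L²(𝕋)` onto `H²_𝒱`. -/
def toeplitz (φ : Symbol) (V : Submodule ℂ L2) : hardySub V →L[ℂ] hardySub V :=
  (hardySub V).orthogonalProjectionOnto ∘L mulSymbol φ ∘L (hardySub V).subtypeL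

/-- `g` is an eigenvector for the eigenvalue `lam` of `φ` relative to the Neil algebra:
for some `𝒱 ⊆ ℂ ⊕ ℂ z`, `g` is a nonzero element of `H²_𝒱` and `T_φ^𝒱 g = lam g`. -/
def IsNeilEigenvector (φ : Symbol) (lam : ℝ) (g : L2) : Prop :=
  ∃ V : Submodule ℂ L2, V ≤ lowDegree ∧ ∃ hg : g ∈ hardySub V,
    g ≠ 0 ∧ toeplitz φ V ⟨g, hg⟩ = (lam : ℂ) • (⟨g, hg⟩ : hardySub V)

/-- `lam` is an eigenvalue of `φ` relative to the Neil algebra. -/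
def IsNeilEigenvalue (φ : Symbol) (lam : ℝ) : Prop :=
  ∃ g : L2, IsNeilEigenvector φ lam g

/-- `g` is an outer function of `H²`: the set of all `p g`, with `p` a polynomial in `z`, is dense
in `H²` (in particular `g ∈ H²`). -/
def IsOuter (g : L2) : Prop :=
  (Submodule.span ℂ (Set.range fun n : ℕ =>
    (fourierLp (T := 2 * Real.pi) ⊤ (n : ℤ) • g : L2))).topologicalClosure = hardy

/-- The real-valued function `cχ + (cχ)^*` on `𝕋`. -/
def trig (c : ℂ) (x : Circ) : ℝ :=
  (c * fourier 1 x + (starRingEnd ℂ) (c * fourier 1 x)).re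

theorem trig_coe (c : ℂ) (x : Circ) :
    (trig c x : ℂ) = c * fourier 1 x + (starRingEnd ℂ) (c * fourier 1 x) := by
  rw [trig, Complex.add_conj, Complex.ofReal_re]

/-- The quotient `u / v` defines an element of `L¹(𝕋)`.  The denominator must be nonzero almost
everywhere, as `x / 0 = 0` in Lean would otherwise hide an infinite quotient. -/
def QuotientMemL1 (u v : Circ → ℝ) : Prop :=
  (∀ᵐ x ∂arc, v x ≠ 0) ∧ Integrable (fun x => u x / v x) arc

end NeilToeplitz

end

noncomputable section

namespace NeilToeplitz

open Filter Topology ComplexConjugate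

/-! Eigenvectors are governed by the real function `(φ - lam) |g|²`. If `g` is an eigenvector for
`𝒱`, then `g` and all `χ ^ n g` with `n ≥ 2` lie in `H²_𝒱`, so the Fourier coefficients of this
function vanish except at `±1`: it equals `dχ + (dχ)^*` (`IsNeilEigenvector.exists_eq_trig`). For
`lam ∈ [m, M]`, `φ - lam` has the sign of `cχ + (cχ)^*`, which forces `d = t c` with `t ≥ 0`. Since
`φ` is not a.e. equal to `lam`, `t > 0`, and `(cχ + (cχ)^*) / (φ - lam) = |g|² / t` is integrable.

Conversely, an integrable quotient is a nonnegative weight `w`, and an outer `f` with `|f|² = w` is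
needed. In place of Szegő's condition `log w ∈ L¹`, a Wold-type argument is used: `k = √w`
dominates, up to a constant, a trigonometric polynomial, so `k` is not in the closed span of `χ ^ n
k`, `n ≥ 1` (`notMem_gen_shift_of_norm_le`). Projecting `k` off that span gives a unimodular `e`
(`exists_unimodular`), and `f = conj e · k` is outer. Such an `f` is an eigenvector for the `𝒱`
consisting of the vectors of `ℂ ⊕ ℂ z` orthogonal to `f` (`isNeilEigenvector_of_isOuter`). Inside
`(m, M)` the denominator is bounded away from zero, so the quotient is always integrable. -/

/-! ### Uniqueness of Fourier coefficients in `L¹` -/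

/-- Integration against `F` is a continuous functional on `C(𝕋)` that kills the trigonometric
polynomials, which are dense. -/
theorem integral_mul_continuous_eq_zero_of_fourierCoeff_eq_zero {F : Circ → ℂ}
    (hF : Integrable F arc) (h0 : ∀ n, fourierCoeff F n = 0) (g : C(Circ, ℂ)) :
    ∫ x, g x * F x ∂arc = 0 := by
  have hint : ∀ g : C(Circ, ℂ), Integrable (fun x => g x * F x) arc := fun g =>
    hF.bdd_mul g.continuous.aestronglyMeasurable
      (Eventually.of_forall fun x => g.norm_coe_le_norm x)
  let Λ : C(Circ, ℂ) →L[ℂ] ℂ := LinearMap.mkContinuous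
    { toFun := fun g => ∫ x, g x * F x ∂arc
      map_add' := fun g h => by
        rw [← integral_add (hint g) (hint h)]
        simp [add_mul]
      map_smul' := fun a g => by
        rw [RingHom.id_apply, smul_eq_mul, ← integral_const_mul]
        simp [mul_assoc] }
    (∫ x, ‖F x‖ ∂arc) (fun g => by
      rw [mul_comm (∫ x, ‖F x‖ ∂arc), ← integral_const_mul]
      refine norm_integral_le_of_norm_le (hF.norm.const_mul _) (Eventually.of_forall fun x => ?_)
      rw [norm_mul]
      exact mul_le_mul_of_nonneg_right (g.norm_coe_le_norm x) (norm_nonneg _))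
  have hle : (Submodule.span ℂ (Set.range <| @fourier (2 * Real.pi))).topologicalClosure
      ≤ LinearMap.ker (Λ : C(Circ, ℂ) →ₗ[ℂ] ℂ) := by
    refine Submodule.topologicalClosure_minimal _ (Submodule.span_le.2 ?_) Λ.isClosed_ker
    rintro _ ⟨n, rfl⟩
    have := h0 (-n)
    rw [fourierCoeff, neg_neg] at this
    exact this
  rw [span_fourier_closure_eq_top] at hle
  exact hle (Submodule.mem_top : g ∈ ⊤)

/-- An integrable function on the circle is determined by its Fourier coefficients. -/
theorem ae_eq_zero_of_fourierCoeff_eq_zero {F : Circ → ℂ}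
    (hF : Integrable F arc) (h0 : ∀ n, fourierCoeff F n = 0) : F =ᵐ[arc] 0 := by
  refine ae_eq_zero_of_forall_setIntegral_isClosed_eq_zero hF fun K hK => ?_
  -- The indicator of a closed set is a bounded pointwise limit of continuous functions, whose
  -- integrals against `F` vanish.
  have hlim : Tendsto (fun n => ∫ x, ((hK.apprSeq n x : ℝ) : ℂ) * F x ∂arc) atTop
      (𝓝 (∫ x, K.indicator F x ∂arc)) := by
    refine tendsto_integral_of_dominated_convergence (fun x => ‖F x‖) (fun n => ?_) hF.norm
      (fun n => Eventually.of_forall fun x => ?_) (Eventually.of_forall fun x => ?_)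
    · refine AEStronglyMeasurable.mul ?_ hF.1
      exact (Complex.continuous_ofReal.comp
        (NNReal.continuous_coe.comp (hK.apprSeq n).continuous)).aestronglyMeasurable
    · rw [norm_mul, Complex.norm_real, NNReal.norm_eq]
      exact mul_le_of_le_one_left (norm_nonneg _) (by exact_mod_cast HasOuterApproxClosed.apprSeq_apply_le_one hK n x)
    · have h1 := (tendsto_pi_nhds.1 (HasOuterApproxClosed.tendsto_apprSeq hK)) x
      have h2 : Tendsto (fun n => ((hK.apprSeq n x : ℝ) : ℂ)) atTop
          (𝓝 (((K.indicator (fun _ => (1 : NNReal)) x : NNReal) : ℝ) : ℂ)) :=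
        (Complex.continuous_ofReal.comp NNReal.continuous_coe).continuousAt.tendsto.comp h1
      have h3 := h2.mul_const (F x)
      by_cases hx : x ∈ K <;> simpa [hx] using h3
  rw [integral_indicator hK.measurableSet] at hlim
  refine tendsto_nhds_unique hlim (Tendsto.congr (fun n => ?_) tendsto_const_nhds)
  exact (integral_mul_continuous_eq_zero_of_fourierCoeff_eq_zero hF h0
    ⟨fun x => ((hK.apprSeq n x : ℝ) : ℂ), Complex.continuous_ofReal.comp
        (NNReal.continuous_coe.comp (hK.apprSeq n).continuous)⟩).symm

/-! ### Multiplication operators and the bilateral shift -/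

/-- Multiplication by a bounded function on `L²(𝕋)`. -/
def mulL (a : Lp ℂ ⊤ arc) : L2 →L[ℂ] L2 :=
  (ContinuousLinearMap.mul ℂ ℂ).holderL arc ⊤ 2 2 a

theorem mulL_coe (a : Lp ℂ ⊤ arc) (f : L2) : mulL a f =ᵐ[arc] fun x => a x * f x :=
  (ContinuousLinearMap.mul ℂ ℂ).coeFn_holder a f

theorem inner_eq_integral (f g : L2) : inner ℂ f g = ∫ x, conj (f x) * g x ∂arc := by
  rw [L2.inner_def]
  simp [RCLike.inner_apply, mul_comm]

/-- Multiplication by `χ ^ n` on `L²(𝕋)`. -/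
def shift (n : ℤ) : L2 →L[ℂ] L2 := mulL (fourierLp ⊤ n)

theorem shift_coe (n : ℤ) (f : L2) : shift n f =ᵐ[arc] fun x => fourier n x * f x := by
  filter_upwards [mulL_coe (fourierLp ⊤ n) f, coeFn_fourierLp (T := 2 * Real.pi) ⊤ n] with x h1 h2
  rw [shift, h1, h2]

theorem shift_eq_smul (n : ℤ) (f : L2) :
    (fourierLp (T := 2 * Real.pi) ⊤ n • f : L2) = shift n f := by
  refine Lp.ext ?_
  filter_upwards [mulL_coe (fourierLp ⊤ n) f,
    Lp.coeFn_lpSMul (r := 2) (fourierLp (T := 2 * Real.pi) ⊤ n) f] with x h1 h2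
  rw [shift, h1, h2, Pi.smul_apply', smul_eq_mul]

theorem shift_shift (m n : ℤ) (f : L2) : shift m (shift n f) = shift (m + n) f := by
  refine Lp.ext ?_
  filter_upwards [shift_coe m (shift n f), shift_coe n f, shift_coe (m + n) f] with x h1 h2 h3
  rw [h1, h2, h3, fourier_add, mul_assoc]

theorem shift_zero (f : L2) : shift 0 f = f := by
  refine Lp.ext ?_
  filter_upwards [shift_coe 0 f] with x h1
  rw [h1, fourier_zero, one_mul]

theorem shift_mulL (n : ℤ) (a : Lp ℂ ⊤ arc) (f : L2) :
    shift n (mulL a f) = mulL a (shift n f) := by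
  refine Lp.ext ?_
  filter_upwards [shift_coe n (mulL a f), shift_coe n f, mulL_coe a f, mulL_coe a (shift n f)]
    with x h1 h2 h3 h4
  rw [h1, h3, h4, h2]
  ring

theorem inner_shift (n : ℤ) (f g : L2) : inner ℂ f (shift n g) = inner ℂ (shift (-n) f) g := by
  rw [inner_eq_integral, inner_eq_integral]
  refine integral_congr_ae ?_
  filter_upwards [shift_coe n g, shift_coe (-n) f] with x h1 h2
  rw [h1, h2, map_mul, fourier_neg, Complex.conj_conj]
  ring

theorem shift_fourierLp (m n : ℤ) :
    shift m (fourierLp (T := 2 * Real.pi) 2 n) = fourierLp 2 (m + n) := by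
  refine Lp.ext ?_
  filter_upwards [shift_coe m (fourierLp 2 n), coeFn_fourierLp (T := 2 * Real.pi) 2 n,
    coeFn_fourierLp (T := 2 * Real.pi) 2 (m + n)] with x h1 h2 h3
  rw [h1, h2, h3, fourier_add]

theorem fourierCoeff_shift (m n : ℤ) (f : L2) :
    fourierCoeff (shift m f : Circ → ℂ) n = fourierCoeff (f : Circ → ℂ) (n - m) := by
  rw [fourierCoeff_eq_inner, fourierCoeff_eq_inner, inner_shift, shift_fourierLp, neg_add_eq_sub]

theorem fourierCoeff_fourierLp (m n : ℤ) :
    fourierCoeff (fourierLp (T := 2 * Real.pi) 2 m : Circ → ℂ) n = if n = m then 1 else 0 := by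
  rw [fourierCoeff_eq_inner]
  exact orthonormal_iff_ite.1 (orthonormal_fourier (T := 2 * Real.pi)) n m

theorem fourierLp_mem_hardy (n : ℕ) : fourierLp (T := 2 * Real.pi) 2 (n : ℤ) ∈ hardy := by
  intro j hj
  rw [fourierCoeff_fourierLp, if_neg (by omega)]

theorem shift_mem_hardy (n : ℕ) {f : L2} (hf : f ∈ hardy) : shift n f ∈ hardy := by
  intro j hj
  rw [fourierCoeff_shift]
  exact hf _ (by omega)

theorem ext_fourierCoeff {f g : L2}
    (h : ∀ n, fourierCoeff (f : Circ → ℂ) n = fourierCoeff (g : Circ → ℂ) n) : f = g := by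
  refine (fourierBasis (T := 2 * Real.pi)).repr.injective (lp.ext (funext fun n => ?_))
  rw [fourierBasis_repr, fourierBasis_repr, h]

/-! ### Cyclic shift-invariant subspaces -/

/-- The closed span of `χ ^ n k`, `n ≥ 0`. -/
def gen (k : L2) : Submodule ℂ L2 :=
  (Submodule.span ℂ (Set.range fun n : ℕ => shift n k)).topologicalClosure

theorem isOuter_iff {g : L2} : IsOuter g ↔ gen g = hardy := by
  simp only [IsOuter, gen, shift_eq_smul]

theorem isClosed_gen (k : L2) : IsClosed (gen k : Set L2) :=
  Submodule.isClosed_topologicalClosure _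

theorem shift_mem_gen (n : ℕ) (k : L2) : shift n k ∈ gen k :=
  Submodule.le_topologicalClosure _ (Submodule.subset_span ⟨n, rfl⟩)

theorem self_mem_gen (k : L2) : k ∈ gen k := by
  simpa [shift_zero] using shift_mem_gen 0 k

/-- The induction principle for `gen k`: a closed linear condition need only be checked on the
shifts of `k`. -/
theorem map_mem_of_mem_gen {E : Type*} [NormedAddCommGroup E] [NormedSpace ℂ E] (T : L2 →L[ℂ] E)
    {S : Submodule ℂ E} (hS : IsClosed (S : Set E)) {k : L2} (h : ∀ n : ℕ, T (shift n k) ∈ S)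
    {x : L2} (hx : x ∈ gen k) : T x ∈ S := by
  have hle : gen k ≤ S.comap (T : L2 →ₗ[ℂ] E) := by
    refine Submodule.topologicalClosure_minimal _ (Submodule.span_le.2 ?_)
      (hS.preimage T.continuous)
    rintro _ ⟨n, rfl⟩
    exact h n
  exact hle hx

theorem map_eq_zero_of_mem_gen {E : Type*} [NormedAddCommGroup E] [NormedSpace ℂ E]
    (T : L2 →L[ℂ] E) {k : L2} (h : ∀ n : ℕ, T (shift n k) = 0) {x : L2} (hx : x ∈ gen k) :
    T x = 0 :=
  (Submodule.mem_bot ℂ).1 <| map_mem_of_mem_gen T (S := ⊥) (by simp)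
    (fun n => (Submodule.mem_bot ℂ).2 (h n)) hx

theorem mem_of_mem_gen {S : Submodule ℂ L2} (hS : IsClosed (S : Set L2)) {k : L2}
    (h : ∀ n : ℕ, shift n k ∈ S) {x : L2} (hx : x ∈ gen k) : x ∈ S :=
  map_mem_of_mem_gen (ContinuousLinearMap.id ℂ L2) hS h hx

theorem shift_mem_gen_of_mem (n : ℕ) {k x : L2} (hx : x ∈ gen k) : shift n x ∈ gen k := by
  refine map_mem_of_mem_gen (shift n) (isClosed_gen k) (fun j => ?_) hx
  rw [shift_shift, ← Nat.cast_add]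
  exact shift_mem_gen _ k

theorem gen_shift_le (k : L2) : gen (shift 1 k) ≤ gen k := fun _ hx =>
  mem_of_mem_gen (isClosed_gen k) (fun n => by
    rw [shift_shift]; exact_mod_cast shift_mem_gen (n + 1) k) hx

theorem hardy_le_of_fourierLp_mem {S : Submodule ℂ L2} (hS : IsClosed (S : Set L2))
    (h : ∀ n : ℕ, fourierLp (T := 2 * Real.pi) 2 (n : ℤ) ∈ S) : hardy ≤ S := by
  intro f hf
  refine hS.mem_of_tendsto (hasSum_fourier_series_L2 f) (Eventually.of_forall fun s => ?_)
  refine S.sum_mem fun n _ => ?_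
  rcases lt_or_ge n 0 with hn | hn
  · rw [hf n hn, zero_smul]; exact S.zero_mem
  · lift n to ℕ using hn
    exact S.smul_mem _ (h n)

/-- A function with a lowest nonzero Fourier coefficient is not in the invariant subspace
generated by its shift. -/
theorem notMem_gen_shift {h : L2} {N : ℤ} (hlow : ∀ n < N, fourierCoeff (h : Circ → ℂ) n = 0)
    (hN : fourierCoeff (h : Circ → ℂ) N ≠ 0) : h ∉ gen (shift 1 h) := by
  intro hmem
  refine hN ?_
  rw [fourierCoeff_eq_inner]
  refine map_eq_zero_of_mem_gen (innerSL ℂ (fourierLp (T := 2 * Real.pi) 2 N)) (fun n => ?_) hmem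
  rw [innerSL_apply_apply, ← fourierCoeff_eq_inner, fourierCoeff_shift, fourierCoeff_shift]
  exact hlow _ (by omega)

/-! ### Unimodular generators and outer functions of prescribed modulus -/

theorem exists_Lp_top_coe {a : Circ → ℂ} (ha : AEStronglyMeasurable a arc) {C : ℝ}
    (hC : ∀ᵐ x ∂arc, ‖a x‖ ≤ C) : ∃ A : Lp ℂ ⊤ arc, A =ᵐ[arc] a :=
  ⟨(memLp_top_of_bound ha C hC).toLp a, MemLp.coeFn_toLp _⟩

theorem integrable_norm_sq (f : L2) : Integrable (fun x => ‖f x‖ ^ 2) arc :=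
  (memLp_two_iff_integrable_sq_norm (Lp.aestronglyMeasurable f)).1 (Lp.memLp f)

theorem fourierCoeff_norm_sq (f : L2) (n : ℤ) :
    fourierCoeff (fun x => ((‖f x‖ ^ 2 : ℝ) : ℂ)) n = inner ℂ f (shift (-n) f) := by
  rw [inner_eq_integral, fourierCoeff]
  refine integral_congr_ae ?_
  filter_upwards [shift_coe (-n) f] with x h
  rw [h, smul_eq_mul, Complex.ofReal_pow, ← Complex.conj_mul']
  ring

/-- The inner products are Fourier coefficients of `|e|²`. This function is real, so vanishing on
one side of `0` gives vanishing on the other, and only the mean survives. -/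
theorem norm_sq_ae_const {e : L2} (h : ∀ n : ℕ, 1 ≤ n → inner ℂ e (shift n e) = 0) :
    ∀ᵐ x ∂arc, ‖e x‖ = ‖e‖ := by
  have h' : ∀ n : ℤ, n ≠ 0 → inner ℂ e (shift n e) = 0 := by
    intro n hn
    rcases lt_or_gt_of_ne hn with hn | hn
    · obtain ⟨j, rfl⟩ : ∃ j : ℕ, n = -j := ⟨n.natAbs, by omega⟩
      rw [inner_shift, neg_neg, ← inner_conj_symm, h j (by omega), map_zero]
    · obtain ⟨j, rfl⟩ : ∃ j : ℕ, n = j := ⟨n.natAbs, by omega⟩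
      exact h j (by omega)
  have hint : Integrable (fun x => ((‖e x‖ ^ 2 : ℝ) : ℂ)) arc := (integrable_norm_sq e).ofReal
  have hconst : ∀ n, fourierCoeff (fun _ : Circ => (-(‖e‖ ^ 2 : ℝ) : ℂ)) n
      = if n = 0 then (-(‖e‖ ^ 2 : ℝ) : ℂ) else 0 := by
    intro n
    have h1 := fourierCoeff.const_mul (T := 2 * Real.pi)
      (fourierLp (T := 2 * Real.pi) 2 0 : Circ → ℂ) (-(‖e‖ ^ 2 : ℝ) : ℂ) n
    rw [fourierCoeff_fourierLp] at h1
    have h2 : (fun x => (-(‖e‖ ^ 2 : ℝ) : ℂ) * (fourierLp (T := 2 * Real.pi) 2 0 : Circ → ℂ) x)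
        =ᵐ[arc] fun _ => (-(‖e‖ ^ 2 : ℝ) : ℂ) := by
      filter_upwards [coeFn_fourierLp (T := 2 * Real.pi) 2 0] with x hx
      rw [hx, fourier_zero, mul_one]
    rw [← fourierCoeff_congr_ae h2, h1]
    simp
  have key := ae_eq_zero_of_fourierCoeff_eq_zero
    (F := (fun x => ((‖e x‖ ^ 2 : ℝ) : ℂ)) + fun _ => (-(‖e‖ ^ 2 : ℝ) : ℂ))
    (hint.add (integrable_const _)) (fun n => by
      rw [fourierCoeff.add hint (integrable_const _), Pi.add_apply, fourierCoeff_norm_sq, hconst]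
      by_cases hn : n = 0
      · subst hn
        rw [neg_zero, shift_zero, inner_self_eq_norm_sq_to_K]
        simp
      · rw [h' _ (neg_ne_zero.2 hn), if_neg hn, add_zero])
  filter_upwards [key] with x hx
  have hx' : ((‖e x‖ ^ 2 : ℝ) : ℂ) = ((‖e‖ ^ 2 : ℝ) : ℂ) := by
    rw [← sub_eq_zero, sub_eq_add_neg]
    exact hx
  exact (sq_eq_sq₀ (norm_nonneg _) (norm_nonneg _)).1 (Complex.ofReal_injective hx')

/-- If `k` is not in the invariant subspace generated by its shift, then the invariant subspace
generated by `k` contains a unimodular function orthogonal to all proper shifts of `k`. -/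
theorem exists_unimodular {k : L2} (hk : k ∉ gen (shift 1 k)) :
    ∃ e ∈ gen k, (∀ᵐ x ∂arc, ‖e x‖ = 1) ∧ ∀ n : ℕ, 1 ≤ n → inner ℂ e (shift n k) = 0 := by
  have : CompleteSpace (gen (shift 1 k)) := (isClosed_gen _).completeSpace_coe
  obtain ⟨p, hp, hperp⟩ : ∃ p ∈ gen (shift 1 k), k - p ∈ (gen (shift 1 k))ᗮ :=
    ⟨_, Submodule.starProjection_apply_mem _ k, Submodule.sub_starProjection_mem_orthogonal k⟩
  have hne : k - p ≠ 0 := fun h => hk (by rwa [← sub_eq_zero.1 h] at hp)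
  have hmem : k - p ∈ gen k := (gen k).sub_mem (self_mem_gen k) (gen_shift_le k hp)
  generalize k - p = e₀ at hperp hne hmem
  have horth : ∀ n : ℕ, 1 ≤ n → inner ℂ e₀ (shift n k) = 0 := by
    intro n hn
    obtain ⟨j, rfl⟩ := Nat.exists_eq_add_of_le' hn
    have h1 : shift ((j + 1 : ℕ) : ℤ) k ∈ gen (shift 1 k) := by
      rw [Nat.cast_add, Nat.cast_one, ← shift_shift]
      exact shift_mem_gen j (shift 1 k)
    exact (gen (shift 1 k)).inner_left_of_mem_orthogonal h1 hperp
  -- Since `e₀ ∈ gen k`, orthogonality to the proper shifts of `k` passes to the proper shifts of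
  -- `e₀` itself.
  have hconst : ∀ᵐ x ∂arc, ‖e₀ x‖ = ‖e₀‖ := norm_sq_ae_const fun n hn => by
    refine map_eq_zero_of_mem_gen (innerSL ℂ e₀ ∘L shift n) (fun j => ?_) hmem
    rw [ContinuousLinearMap.comp_apply, innerSL_apply_apply, shift_shift]
    exact_mod_cast horth (n + j) (by omega)
  have hnorm : ‖e₀‖ ≠ 0 := norm_ne_zero_iff.2 hne
  refine ⟨((‖e₀‖⁻¹ : ℝ) : ℂ) • e₀, (gen k).smul_mem _ hmem, ?_, fun n hn => ?_⟩
  · filter_upwards [hconst, Lp.coeFn_smul ((‖e₀‖⁻¹ : ℝ) : ℂ) e₀] with x h1 h2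
    rw [h2, Pi.smul_apply, norm_smul, h1, Complex.norm_real, norm_inv, norm_norm,
      inv_mul_cancel₀ hnorm]
  · rw [inner_smul_left, horth n hn, mul_zero]

/-- A nonzero function in `H²` is nonzero almost everywhere. -/
theorem ae_ne_zero_of_mem_hardy {g : L2} (hg : g ∈ hardy) (hg0 : g ≠ 0) :
    ∀ᵐ x ∂arc, g x ≠ 0 := by
  have hex : ∃ n : ℕ, fourierCoeff (g : Circ → ℂ) n ≠ 0 := by
    by_contra! hall
    refine hg0 (ext_fourierCoeff fun n => ?_)
    have h0 : fourierCoeff ((0 : L2) : Circ → ℂ) n = 0 := by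
      rw [fourierCoeff_eq_inner, inner_zero_right]
    rw [h0]
    rcases lt_or_ge n 0 with hn | hn
    · exact hg n hn
    · lift n to ℕ using hn
      exact hall n
  classical
  have hlow : ∀ n < ((Nat.find hex : ℕ) : ℤ), fourierCoeff (g : Circ → ℂ) n = 0 := by
    intro n hn
    rcases lt_or_ge n 0 with h | h
    · exact hg n h
    · lift n to ℕ using h
      exact not_not.1 (Nat.find_min hex (by exact_mod_cast hn))
  obtain ⟨e, he, hune, -⟩ := exists_unimodular (notMem_gen_shift hlow (Nat.find_spec hex))
  have hZ : MeasurableSet {x | g x = 0} :=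
    (Lp.stronglyMeasurable g).measurable (measurableSet_singleton 0)
  obtain ⟨a, ha⟩ := exists_Lp_top_coe (a := {x | g x = 0}.indicator 1) (C := 1)
    ((measurable_one.indicator hZ).aestronglyMeasurable) (Eventually.of_forall fun x => by
      by_cases hx : x ∈ {x | g x = 0} <;> simp [hx])
  -- Every element of `gen g` vanishes on the zero set of `g`; the unimodular `e` is one, so that
  -- set is null.
  have hzero : mulL a e = 0 := map_eq_zero_of_mem_gen (mulL a) (fun n => by
    refine Lp.ext ?_
    filter_upwards [mulL_coe a (shift n g), shift_coe n g, ha, Lp.coeFn_zero ℂ 2 arc]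
      with x h1 h2 h3 h4
    rw [h1, h2, h3, h4]
    by_cases hx : g x = 0 <;> simp [hx]) he
  filter_upwards [mulL_coe a e, ha, hune, Lp.coeFn_zero ℂ 2 arc] with x h1 h2 h3 h4 h5
  rw [hzero, h4, h2, Set.indicator_of_mem (by exact h5)] at h1
  have : e x = 0 := by simpa using h1.symm
  rw [this, norm_zero] at h3
  exact zero_ne_one h3

/-- Take `f = conj e · k`, with `e` the unimodular generator. Orthogonality of `e` to the proper
shifts of `k` puts `f` in `H²`; multiplying `e ∈ gen k` by `conj e` puts `1` in `gen f`. -/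
theorem exists_isOuter_norm_eq {k : L2} (hk : k ∉ gen (shift 1 k)) :
    ∃ f : L2, IsOuter f ∧ ∀ᵐ x ∂arc, ‖f x‖ = ‖k x‖ := by
  obtain ⟨e, he, hune, horth⟩ := exists_unimodular hk
  obtain ⟨a, ha⟩ := exists_Lp_top_coe (a := fun x => conj (e x)) (C := 1)
    (Complex.continuous_conj.comp_aestronglyMeasurable (Lp.aestronglyMeasurable e))
    (hune.mono fun x hx => by rw [RCLike.norm_conj, hx])
  refine ⟨mulL a k, isOuter_iff.2 (le_antisymm ?_ ?_), ?_⟩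
  · intro x hx
    refine mem_of_mem_gen isClosed_hardy (fun n j hj => ?_) hx
    rw [shift_mulL, fourierCoeff_eq_inner]
    have : inner ℂ (fourierLp (T := 2 * Real.pi) 2 j) (mulL a (shift n k))
        = inner ℂ e (shift (n - j) k) := by
      rw [inner_eq_integral, inner_eq_integral]
      refine integral_congr_ae ?_
      filter_upwards [mulL_coe a (shift n k), ha, shift_coe n k, shift_coe (n - j) k,
        coeFn_fourierLp (T := 2 * Real.pi) 2 j] with x h1 h2 h3 h4 h5
      rw [h1, h2, h3, h4, h5, sub_eq_add_neg, fourier_add, fourier_neg]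
      ring
    -- As `j < 0 ≤ n`, this is a proper shift.
    obtain ⟨m, hm⟩ : ∃ m : ℕ, (n : ℤ) - j = m := ⟨((n : ℤ) - j).natAbs, by omega⟩
    rw [this, hm]
    exact horth m (by omega)
  · refine hardy_le_of_fourierLp_mem (isClosed_gen _) fun n => ?_
    have h1 : mulL a (shift n e) ∈ gen (mulL a k) :=
      map_mem_of_mem_gen (mulL a) (isClosed_gen _)
        (fun j => by rw [← shift_mulL]; exact shift_mem_gen j _) (shift_mem_gen_of_mem n he)
    convert h1 using 1
    refine Lp.ext ?_
    filter_upwards [mulL_coe a (shift n e), ha, shift_coe n e, hune,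
      coeFn_fourierLp (T := 2 * Real.pi) 2 n] with x h1 h2 h3 h4 h5
    rw [h1, h2, h3, h5, mul_left_comm, Complex.conj_mul', h4]
    simp
  · filter_upwards [mulL_coe a k, ha, hune] with x h1 h2 h3
    rw [h1, h2, norm_mul, RCLike.norm_conj, h3, one_mul]

/-- A function dominating, up to a bounded factor, a function with a lowest nonzero Fourier
coefficient is not in the invariant subspace generated by its shift. -/
theorem notMem_gen_shift_of_norm_le {k h : L2} {C : ℝ} {N : ℤ}
    (hlow : ∀ n < N, fourierCoeff (h : Circ → ℂ) n = 0)
    (hN : fourierCoeff (h : Circ → ℂ) N ≠ 0) (hC : ∀ᵐ x ∂arc, ‖h x‖ ≤ C * ‖k x‖) :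
    k ∉ gen (shift 1 k) := by
  intro hk
  have hC' : ∀ᵐ x ∂arc, ‖h x / k x‖ ≤ |C| := by
    filter_upwards [hC] with x hx
    rcases eq_or_ne (k x) 0 with h0 | h0
    · simp [h0]
    · rw [norm_div, div_le_iff₀ (norm_pos_iff.2 h0)]
      exact hx.trans (by gcongr; exact le_abs_self C)
  obtain ⟨a, ha⟩ := exists_Lp_top_coe (a := fun x => h x / k x) (C := |C|)
    ((Lp.stronglyMeasurable h).measurable.div
      (Lp.stronglyMeasurable k).measurable).aestronglyMeasurable hC'
  -- Where `k` vanishes so does `h`, so the convention `h / 0 = 0` does no harm.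
  have hak : mulL a k = h := by
    refine Lp.ext ?_
    filter_upwards [mulL_coe a k, ha, hC] with x h1 h2 h3
    rw [h1, h2]
    rcases eq_or_ne (k x) 0 with h0 | h0
    · rw [h0, norm_zero, mul_zero] at h3
      rw [h0, mul_zero, norm_le_zero_iff.1 h3]
    · exact div_mul_cancel₀ _ h0
  refine notMem_gen_shift hlow hN ?_
  -- Multiplying `k ∈ gen (χ k)` by `h / k` would give `h ∈ gen (χ h)`.
  have := map_mem_of_mem_gen (mulL a) (isClosed_gen (shift 1 h)) (fun n => by
    rw [← shift_mulL, ← shift_mulL, hak]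
    exact shift_mem_gen n _) hk
  rwa [hak] at this

/-! ### Outer functions: uniqueness from the modulus -/

theorem mulL_mem_hardy {a : Lp ℂ ⊤ arc} {f : L2} (hf : IsOuter f) (h : mulL a f ∈ hardy)
    {g : L2} (hg : g ∈ hardy) : mulL a g ∈ hardy := by
  rw [← isOuter_iff.1 hf] at hg
  refine map_mem_of_mem_gen (mulL a) isClosed_hardy (fun n => ?_) hg
  rw [← shift_mulL]
  exact shift_mem_hardy n h

theorem IsOuter.mem_hardy {f : L2} (hf : IsOuter f) : f ∈ hardy :=
  isOuter_iff.1 hf ▸ self_mem_gen f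

/-- An outer function is determined by its modulus, up to a unimodular constant. -/
theorem IsOuter.eq_smul_of_norm_eq {f h : L2} (hf : IsOuter f) (hh : IsOuter h)
    (hne : ∀ᵐ x ∂arc, f x ≠ 0) (hn : ∀ᵐ x ∂arc, ‖f x‖ = ‖h x‖) :
    ∃ u : ℂ, ‖u‖ = 1 ∧ h = u • f := by
  obtain ⟨a, ha⟩ := exists_Lp_top_coe (a := fun x => h x / f x) (C := 1)
    ((Lp.stronglyMeasurable h).measurable.div
      (Lp.stronglyMeasurable f).measurable).aestronglyMeasurable (by
        filter_upwards [hn, hne] with x h1 h2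
        rw [norm_div, h1, div_self (h1 ▸ norm_ne_zero_iff.2 h2)])
  obtain ⟨b, hb⟩ := exists_Lp_top_coe (a := fun x => conj (a x)) (C := 1)
    (Complex.continuous_conj.comp_aestronglyMeasurable (Lp.aestronglyMeasurable a)) (by
        filter_upwards [hn, hne, ha] with x h1 h2 h3
        rw [RCLike.norm_conj, h3, norm_div, h1, div_self (h1 ▸ norm_ne_zero_iff.2 h2)])
  have haf : mulL a f = h := by
    refine Lp.ext ?_
    filter_upwards [mulL_coe a f, ha, hne] with x h1 h2 h3
    rw [h1, h2, div_mul_cancel₀ _ h3]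
  have hnorm : ∀ᵐ x ∂arc, ‖a x‖ = 1 := by
    filter_upwards [hn, hne, ha] with x h1 h2 h3
    rw [h3, norm_div, h1, div_self (h1 ▸ norm_ne_zero_iff.2 h2)]
  have hbh : mulL b h = f := by
    rw [← haf]
    refine Lp.ext ?_
    filter_upwards [mulL_coe b (mulL a f), mulL_coe a f, hb, hnorm] with x h1 h2 h3 h4
    rw [h1, h2, h3, ← mul_assoc, Complex.conj_mul', h4]
    simp
  -- The unimodular `a = h / f` and its conjugate `b = f / h` both multiply `H²` into itself.
  -- Applied to `1`, this puts `a` and `conj a` in `H²`, so `a` is constant.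
  have h1 := mulL_mem_hardy hf (haf ▸ hh.mem_hardy) (fourierLp_mem_hardy 0)
  have h2 := mulL_mem_hardy hh (hbh ▸ hf.mem_hardy) (fourierLp_mem_hardy 0)
  set w := mulL a (fourierLp (T := 2 * Real.pi) 2 ((0 : ℕ) : ℤ)) with hw
  have hwa : w =ᵐ[arc] a := by
    filter_upwards [mulL_coe a (fourierLp (T := 2 * Real.pi) 2 ((0 : ℕ) : ℤ)),
      coeFn_fourierLp (T := 2 * Real.pi) 2 ((0 : ℕ) : ℤ)] with x h1 h2
    rw [hw, h1, h2, Nat.cast_zero, fourier_zero, mul_one]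
  have hconj : ∀ n : ℤ, fourierCoeff (mulL b (fourierLp (T := 2 * Real.pi) 2 ((0 : ℕ) : ℤ)) :
      Circ → ℂ) n = conj (fourierCoeff (w : Circ → ℂ) (-n)) := by
    intro n
    rw [fourierCoeff, fourierCoeff, ← integral_conj]
    refine integral_congr_ae ?_
    filter_upwards [mulL_coe b (fourierLp (T := 2 * Real.pi) 2 ((0 : ℕ) : ℤ)), hwa, hb,
      coeFn_fourierLp (T := 2 * Real.pi) 2 ((0 : ℕ) : ℤ)] with x h1 h2 h3 h4
    rw [h1, h2, h3, h4, Nat.cast_zero, fourier_zero, mul_one, smul_eq_mul, smul_eq_mul, map_mul,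
      ← fourier_neg, neg_neg]
  set u := fourierCoeff (w : Circ → ℂ) 0 with hu
  have hwu : w = u • fourierLp (T := 2 * Real.pi) 2 0 := by
    refine ext_fourierCoeff fun n => ?_
    rw [fourierCoeff_eq_inner (u • _), inner_smul_right, ← fourierCoeff_eq_inner,
      fourierCoeff_fourierLp]
    rcases lt_trichotomy n 0 with hn | rfl | hn
    · rw [h1 n hn, if_neg hn.ne, mul_zero]
    · simp [hu]
    · have := h2 (-n) (by omega)
      rw [hconj, neg_neg, map_eq_zero] at this
      rw [this, if_neg hn.ne', mul_zero]
  have hau : ∀ᵐ x ∂arc, a x = u := by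
    filter_upwards [hwa, coeFn_fourierLp (T := 2 * Real.pi) 2 0,
      Lp.coeFn_smul u (fourierLp (T := 2 * Real.pi) 2 0)] with x h1 h2 h3
    rw [← h1, hwu, h3, Pi.smul_apply, h2, fourier_zero, smul_eq_mul, mul_one]
  refine ⟨u, ?_, ?_⟩
  · obtain ⟨x, h1, h2⟩ := (hau.and hnorm).exists
    rw [← h1, h2]
  · rw [← haf]
    refine Lp.ext ?_
    filter_upwards [mulL_coe a f, hau, Lp.coeFn_smul u f] with x h1 h2 h3
    rw [h1, h2, h3, Pi.smul_apply, smul_eq_mul]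

/-! ### The trigonometric polynomial `cχ + (cχ)^*` -/

/-- The function `cχ + (cχ)^*` as an element of `L²(𝕋)`. -/
def trigL2 (c : ℂ) : L2 :=
  c • fourierLp (T := 2 * Real.pi) 2 1 + conj c • fourierLp (T := 2 * Real.pi) 2 (-1)

theorem trigL2_coe (c : ℂ) : trigL2 c =ᵐ[arc] fun x => (trig c x : ℂ) := by
  filter_upwards [Lp.coeFn_add (c • fourierLp (T := 2 * Real.pi) 2 1)
    (conj c • fourierLp (T := 2 * Real.pi) 2 (-1)),
    Lp.coeFn_smul c (fourierLp (T := 2 * Real.pi) 2 1),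
    Lp.coeFn_smul (conj c) (fourierLp (T := 2 * Real.pi) 2 (-1)),
    coeFn_fourierLp (T := 2 * Real.pi) 2 1, coeFn_fourierLp (T := 2 * Real.pi) 2 (-1)]
    with x h1 h2 h3 h4 h5
  rw [trigL2, h1, Pi.add_apply, h2, h3, Pi.smul_apply, Pi.smul_apply, h4, h5, trig_coe,
    fourier_neg, map_mul, smul_eq_mul, smul_eq_mul]

theorem fourierCoeff_trigL2 (c : ℂ) (n : ℤ) : fourierCoeff (trigL2 c : Circ → ℂ) n
    = (if n = 1 then c else 0) + if n = -1 then conj c else 0 := by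
  rw [fourierCoeff_eq_inner, trigL2, inner_add_right, inner_smul_right, inner_smul_right,
    ← fourierCoeff_eq_inner, ← fourierCoeff_eq_inner, fourierCoeff_fourierLp,
    fourierCoeff_fourierLp, mul_ite, mul_ite, mul_one, mul_zero, mul_one, mul_zero]

theorem fourierCoeff_trig (c : ℂ) (n : ℤ) : fourierCoeff (fun x => (trig c x : ℂ)) n
    = (if n = 1 then c else 0) + if n = -1 then conj c else 0 := by
  rw [← fourierCoeff_trigL2, fourierCoeff_congr_ae (trigL2_coe c)]

theorem continuous_trig (c : ℂ) : Continuous (trig c) := by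
  unfold trig
  fun_prop

theorem trig_eq (c : ℂ) (x : Circ) : trig c x = 2 * (c * fourier 1 x).re := by
  rw [trig, Complex.add_re, Complex.conj_re, ← two_mul]

theorem norm_fourier_apply (n : ℤ) (x : Circ) : ‖fourier n x‖ = 1 := by
  rw [fourier_apply]
  exact Circle.norm_coe _

theorem abs_trig_le (c : ℂ) (x : Circ) : |trig c x| ≤ 2 * ‖c‖ := by
  rw [trig_eq, abs_mul, abs_two]
  have := Complex.abs_re_le_norm (c * fourier 1 x)
  rw [norm_mul, norm_fourier_apply, mul_one] at this
  linarith

theorem fourierCoeff_trigL2_neg_one {c : ℂ} (hc : c ≠ 0) :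
    fourierCoeff (trigL2 c : Circ → ℂ) (-1) ≠ 0 := by
  rw [fourierCoeff_trigL2]
  simpa using hc

theorem fourierCoeff_trigL2_of_lt (c : ℂ) {n : ℤ} (hn : n < -1) :
    fourierCoeff (trigL2 c : Circ → ℂ) n = 0 := by
  rw [fourierCoeff_trigL2, if_neg (by omega), if_neg (by omega), add_zero]

/-- Multiplied by `χ`, the polynomial becomes a nonzero element of `H²`. -/
theorem ae_trig_ne_zero {c : ℂ} (hc : c ≠ 0) : ∀ᵐ x ∂arc, trig c x ≠ 0 := by
  have h1 : shift 1 (trigL2 c) ∈ hardy := fun n hn => by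
    rw [fourierCoeff_shift]
    exact fourierCoeff_trigL2_of_lt c (by omega)
  have h2 : shift 1 (trigL2 c) ≠ 0 := fun h => by
    have h3 := fourierCoeff_shift 1 0 (trigL2 c)
    rw [h, fourierCoeff_eq_inner, inner_zero_right, zero_sub] at h3
    exact fourierCoeff_trigL2_neg_one hc h3.symm
  filter_upwards [ae_ne_zero_of_mem_hardy h1 h2, shift_coe 1 (trigL2 c), trigL2_coe c]
    with x h3 h4 h5 h6
  rw [h4, h5, h6] at h3
  simp at h3

theorem trig_smul (r : ℝ) (c : ℂ) (x : Circ) : trig (r * c) x = r * trig c x := by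
  rw [trig_eq, trig_eq, mul_assoc, Complex.re_ofReal_mul]
  ring

/-- If `trig d` has the sign of `trig c` almost everywhere, then `d` is a nonnegative multiple
of `c`. -/
theorem exists_eq_mul_of_trig_mul_nonneg {c d : ℂ} (hc : c ≠ 0)
    (h : ∀ᵐ x ∂arc, 0 ≤ trig d x * trig c x) : ∃ t : ℝ, 0 ≤ t ∧ d = t * c := by
  -- A set of full measure is dense, so by continuity the inequality holds everywhere.
  have hall : ∀ x, 0 ≤ trig d x * trig c x := by
    have hcl : IsClosed {x | 0 ≤ trig d x * trig c x} :=
      isClosed_le continuous_const ((continuous_trig d).mul (continuous_trig c))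
    have hd : Dense {x | 0 ≤ trig d x * trig c x} := Measure.dense_of_ae h
    intro x
    have : x ∈ closure {x | 0 ≤ trig d x * trig c x} := hd x
    rwa [hcl.closure_eq] at this
  have hre : ∀ u : ℂ, 0 ≤ (d * u).re * (c * u).re := by
    intro u
    obtain ⟨x, hx⟩ : ∃ x : Circ, fourier 1 x = Complex.exp (u.arg * Complex.I) := by
      refine ⟨(u.arg : ℝ), ?_⟩
      rw [fourier_coe_apply]
      congr 1
      have : (Real.pi : ℂ) ≠ 0 := by exact_mod_cast Real.pi_ne_zero
      push_cast
      field_simp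
    have hu : u = (‖u‖ : ℝ) * fourier 1 x := by rw [hx, Complex.norm_mul_exp_arg_mul_I]
    have hx' := hall x
    rw [trig_eq, trig_eq] at hx'
    rw [hu, mul_left_comm, mul_left_comm c, Complex.re_ofReal_mul, Complex.re_ofReal_mul]
    have : 0 ≤ ‖u‖ ^ 2 * ((d * fourier 1 x).re * (c * fourier 1 x).re) := by
      apply mul_nonneg (sq_nonneg _); linarith
    linarith
  have hcpos : 0 < Complex.normSq c := Complex.normSq_pos.2 hc
  -- Test at `u = conj c * (1 + iy)`, where `Re (c u) = |c|² > 0` for every `y`. An affine function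
  -- of `y` that is nonnegative on the whole line has zero slope.
  have hline : ∀ y : ℝ, 0 ≤ (d * conj c).re - y * (d * conj c).im := by
    intro y
    have h1 := hre (conj c * (1 + y * Complex.I))
    have h2 : (c * (conj c * (1 + y * Complex.I))).re = Complex.normSq c := by
      rw [← mul_assoc, Complex.mul_conj, Complex.re_ofReal_mul]
      simp
    have h3 : (d * (conj c * (1 + y * Complex.I))).re
        = (d * conj c).re - y * (d * conj c).im := by
      rw [← mul_assoc, Complex.mul_re]
      simp
      ring
    rw [h2, h3] at h1
    exact nonneg_of_mul_nonneg_left h1 hcpos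
  have him : (d * conj c).im = 0 := by
    by_contra hne
    have := hline (((d * conj c).re + 1) / (d * conj c).im)
    rw [div_mul_cancel₀ _ hne] at this
    linarith
  have hre0 : 0 ≤ (d * conj c).re := by simpa using hline 0
  refine ⟨(d * conj c).re / Complex.normSq c, div_nonneg hre0 hcpos.le, ?_⟩
  have h4 : (((d * conj c).re : ℝ) : ℂ) = d * conj c := Complex.ext (by simp) (by simp [him])
  rw [Complex.ofReal_div, h4, ← Complex.mul_conj]
  have : conj c ≠ 0 := by simpa using hc
  field_simp

/-! ### Eigenvectors and the function `(φ - lam) |g|²` -/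

theorem symbol_sub_smul_coe (φ : Symbol) (lam : ℝ) (g : L2) :
    (mulSymbol φ g - (lam : ℂ) • g : L2) =ᵐ[arc] fun x => ((φ x - lam : ℝ) : ℂ) * g x := by
  filter_upwards [Lp.coeFn_sub (mulSymbol φ g) ((lam : ℂ) • g), mulSymbol_coe φ g,
    Lp.coeFn_smul (lam : ℂ) g] with x h1 h2 h3
  rw [h1, Pi.sub_apply, h2, h3, Pi.smul_apply, smul_eq_mul, Complex.ofReal_sub, sub_mul]

theorem inner_shift_symbol_sub (φ : Symbol) (lam : ℝ) (g : L2) (n : ℤ) :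
    inner ℂ (shift n g) (mulSymbol φ g - (lam : ℂ) • g)
      = fourierCoeff (fun x => (((φ x - lam) * ‖g x‖ ^ 2 : ℝ) : ℂ)) n := by
  rw [inner_eq_integral, fourierCoeff]
  refine integral_congr_ae ?_
  filter_upwards [symbol_sub_smul_coe φ lam g, shift_coe n g] with x h1 h2
  rw [h1, h2, map_mul, fourier_neg, smul_eq_mul, Complex.ofReal_mul, Complex.ofReal_pow,
    ← Complex.conj_mul']
  ring

theorem isNeilEigenvector_iff {φ : Symbol} {lam : ℝ} {g : L2} :
    IsNeilEigenvector φ lam g ↔ ∃ V ≤ lowDegree, g ∈ hardySub V ∧ g ≠ 0 ∧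
      ∀ h ∈ hardySub V, inner ℂ h (mulSymbol φ g - (lam : ℂ) • g) = 0 := by
  have key : ∀ V : Submodule ℂ L2, ∀ hg : g ∈ hardySub V,
      toeplitz φ V ⟨g, hg⟩ = (lam : ℂ) • (⟨g, hg⟩ : hardySub V) ↔
        ∀ h ∈ hardySub V, inner ℂ h (mulSymbol φ g - (lam : ℂ) • g) = 0 := by
    intro V hg
    have h1 : toeplitz φ V ⟨g, hg⟩ - (lam : ℂ) • (⟨g, hg⟩ : hardySub V)
        = (hardySub V).orthogonalProjectionOnto (mulSymbol φ g - (lam : ℂ) • g) := by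
      have h2 := (hardySub V).orthogonalProjectionOnto_mem_subspace_eq_self ⟨g, hg⟩
      rw [map_sub, map_smul, h2]
      rfl
    rw [← sub_eq_zero, h1, Submodule.orthogonalProjectionOnto_eq_zero_iff,
      Submodule.mem_orthogonal]
  constructor
  · rintro ⟨V, hV, hg, hne, h⟩
    exact ⟨V, hV, hg, hne, (key V hg).1 h⟩
  · rintro ⟨V, hV, hg, hne, h⟩
    exact ⟨V, hV, hg, hne, (key V hg).2 h⟩

/-- Otherwise every `χ ^ n f` has mean zero, and the constant `1` is out of reach. -/
theorem IsOuter.fourierCoeff_zero_ne_zero {f : L2} (hf : IsOuter f) :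
    fourierCoeff (f : Circ → ℂ) 0 ≠ 0 := by
  intro h0
  have h1 : fourierLp (T := 2 * Real.pi) 2 ((0 : ℕ) : ℤ) ∈ gen f :=
    isOuter_iff.1 hf ▸ fourierLp_mem_hardy 0
  have h2 := map_eq_zero_of_mem_gen (innerSL ℂ (fourierLp (T := 2 * Real.pi) 2 0)) (fun n => by
    rw [innerSL_apply_apply, ← fourierCoeff_eq_inner, fourierCoeff_shift]
    rcases n.eq_zero_or_pos with rfl | hn
    · simpa using h0
    · exact hf.mem_hardy _ (by omega)) h1
  rw [innerSL_apply_apply, ← fourierCoeff_eq_inner, fourierCoeff_fourierLp] at h2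
  simp at h2

/-- With `𝒱` the part of `ℂ ⊕ ℂ z` orthogonal to `f`, `H²_𝒱 = ℂ f + χ² H²`, and as `f` is outer, `χ²
H²` is the closed span of `χ ^ n f`, `n ≥ 2`. Orthogonality of `(φ - lam) f` to these is the
vanishing of the coefficients of `cχ + (cχ)^*` at `0` and at `n ≥ 2`. -/
theorem isNeilEigenvector_of_isOuter {φ : Symbol} {lam : ℝ} {c : ℂ} {f : L2} (hf : IsOuter f)
    (h : ∀ᵐ x ∂arc, (φ x - lam) * ‖f x‖ ^ 2 = trig c x) : IsNeilEigenvector φ lam f := by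
  have hf0 := hf.fourierCoeff_zero_ne_zero
  have hcoeff : ∀ n : ℤ, inner ℂ (shift n f) (mulSymbol φ f - (lam : ℂ) • f)
      = (if n = 1 then c else 0) + if n = -1 then conj c else 0 := by
    intro n
    rw [inner_shift_symbol_sub, ← fourierCoeff_trig]
    exact congrFun (fourierCoeff_congr_ae (h.mono fun x hx => by simp only [hx])) n
  rw [isNeilEigenvector_iff]
  refine ⟨lowDegree ⊓ (Submodule.span ℂ {f})ᗮ, inf_le_left, ⟨hf.mem_hardy, ?_⟩, ?_, ?_⟩
  · refine (Submodule.mem_orthogonal _ _).2 fun v hv => ?_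
    exact Submodule.inner_left_of_mem_orthogonal (Submodule.mem_span_singleton_self f) hv.2
  · rintro rfl
    rw [fourierCoeff_eq_inner, inner_zero_right] at hf0
    exact hf0 rfl
  · rintro g ⟨hg, hgV⟩
    set f₀ := fourierCoeff (f : Circ → ℂ) 0 with hf₀
    set f₁ := fourierCoeff (f : Circ → ℂ) 1 with hf₁
    set g₀ := fourierCoeff (g : Circ → ℂ) 0 with hg₀
    set g₁ := fourierCoeff (g : Circ → ℂ) 1 with hg₁
    -- The vector `conj f₁ - conj f₀ χ` lies in `𝒱`; orthogonality to it makes `(g₀, g₁)`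
    -- proportional to `(f₀, f₁)`.
    have hinner : ∀ w : L2, inner ℂ (conj f₁ • fourierLp (T := 2 * Real.pi) 2 0
        - conj f₀ • fourierLp (T := 2 * Real.pi) 2 1) w
        = f₁ * fourierCoeff (w : Circ → ℂ) 0 - f₀ * fourierCoeff (w : Circ → ℂ) 1 := by
      intro w
      rw [inner_sub_left, inner_smul_left, inner_smul_left, Complex.conj_conj, Complex.conj_conj,
        ← fourierCoeff_eq_inner, ← fourierCoeff_eq_inner]
    have hrel : f₁ * g₀ - f₀ * g₁ = 0 := by
      rw [hg₀, hg₁, ← hinner]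
      refine (Submodule.mem_orthogonal _ _).1 hgV _ ⟨?_, ?_⟩
      · exact Submodule.sub_mem _
          (Submodule.smul_mem _ _ (Submodule.subset_span (Set.mem_insert _ _)))
          (Submodule.smul_mem _ _ (Submodule.subset_span (Set.mem_insert_of_mem _ rfl)))
      · refine Submodule.mem_orthogonal_singleton_iff_inner_left.2 ?_
        rw [hinner]
        ring
    -- Both low coefficients of `r` vanish, so `r ∈ χ² H²`.
    set r : L2 := g - (g₀ / f₀) • f with hr
    have hrc : ∀ n, fourierCoeff (r : Circ → ℂ) n = fourierCoeff (g : Circ → ℂ) n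
        - (g₀ / f₀) * fourierCoeff (f : Circ → ℂ) n := by
      intro n
      rw [fourierCoeff_eq_inner, hr, inner_sub_right, inner_smul_right, ← fourierCoeff_eq_inner,
        ← fourierCoeff_eq_inner]
    have hrmem : shift (-2) r ∈ gen f := by
      rw [isOuter_iff.1 hf]
      intro n hn
      rw [fourierCoeff_shift, hrc]
      rcases lt_or_ge n (-2) with h2 | h2
      · rw [hg _ (by omega), hf.mem_hardy _ (by omega), mul_zero, sub_zero]
      · obtain rfl | rfl : n = -1 ∨ n = -2 := by omega
        · norm_num
          rw [← hg₁, ← hf₁, sub_eq_zero, div_mul_eq_mul_div, eq_div_iff hf0]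
          linear_combination -hrel
        · norm_num
          rw [← hg₀, ← hf₀, div_mul_cancel₀ _ hf0, sub_self]
    have hr0 : inner ℂ (mulSymbol φ f - (lam : ℂ) • f) r = 0 := by
      have h1 := map_eq_zero_of_mem_gen
        (innerSL ℂ (mulSymbol φ f - (lam : ℂ) • f) ∘L shift 2) (fun n => by
          rw [ContinuousLinearMap.comp_apply, innerSL_apply_apply, shift_shift,
            ← inner_conj_symm, hcoeff, if_neg (by omega), if_neg (by omega), add_zero,
            map_zero]) hrmem
      rw [ContinuousLinearMap.comp_apply, innerSL_apply_apply, shift_shift] at h1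
      simpa [shift_zero] using h1
    have hff : inner ℂ f (mulSymbol φ f - (lam : ℂ) • f) = 0 := by
      have h1 := hcoeff 0
      rw [shift_zero] at h1
      simpa using h1
    have hg' : g = r + (g₀ / f₀) • f := by rw [hr, sub_add_cancel]
    rw [hg', inner_add_left, inner_smul_left, hff, mul_zero, add_zero, ← inner_conj_symm, hr0,
      map_zero]

theorem ae_abs_symbol_sub_le (φ : Symbol) (lam : ℝ) : ∀ᵐ x ∂arc, |φ x - lam| ≤ ‖φ‖ + |lam| := by
  have hbound : ∀ᵐ x ∂arc, ‖φ x‖ ≤ ‖φ‖ := by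
    filter_upwards [ae_le_eLpNormEssSup (f := φ) (μ := arc)] with x hx
    rw [← eLpNorm_exponent_top] at hx
    rw [Lp.norm_def, ← toReal_enorm]
    exact ENNReal.toReal_mono (Lp.eLpNorm_ne_top φ) hx
  filter_upwards [hbound] with x hx
  exact (abs_sub _ _).trans (add_le_add hx le_rfl)

/-! ### Outer eigenvectors from integrable quotients -/

theorem exists_isOuter_of_quotientMemL1 {φ : Symbol} {lam : ℝ} {c : ℂ} (hc : c ≠ 0)
    (hsign : ∀ᵐ x ∂arc, 0 ≤ (φ x - lam) * trig c x)
    (hq : QuotientMemL1 (trig c) (fun x => φ x - lam)) :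
    ∃ f : L2, IsOuter f ∧ ∀ᵐ x ∂arc, (φ x - lam) * ‖f x‖ ^ 2 = trig c x := by
  obtain ⟨hne, hint⟩ := hq
  have hw : ∀ᵐ x ∂arc, 0 ≤ trig c x / (φ x - lam) := by
    filter_upwards [hsign] with x hx
    have h1 : trig c x / (φ x - lam) = (φ x - lam) * trig c x / (φ x - lam) ^ 2 := by
      rcases eq_or_ne (φ x - lam) 0 with h0 | h0
      · simp [h0]
      · field_simp
    rw [h1]
    positivity
  have hmeas : AEStronglyMeasurable (fun x => ((√(trig c x / (φ x - lam)) : ℝ) : ℂ)) arc :=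
    (Complex.continuous_ofReal.comp Real.continuous_sqrt).comp_aestronglyMeasurable hint.1
  have hL2 : MemLp (fun x => ((√(trig c x / (φ x - lam)) : ℝ) : ℂ)) 2 arc := by
    rw [memLp_two_iff_integrable_sq_norm hmeas]
    refine hint.congr ?_
    filter_upwards [hw] with x hx
    rw [Complex.norm_real, Real.norm_eq_abs, sq_abs, Real.sq_sqrt hx]
  have hk : ∀ᵐ x ∂arc, ‖hL2.toLp _ x‖ = √(trig c x / (φ x - lam)) := by
    filter_upwards [hL2.coeFn_toLp] with x hx
    rw [hx, Complex.norm_real, Real.norm_eq_abs, abs_of_nonneg (Real.sqrt_nonneg _)]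
  -- With `w` the quotient, `|trig c|² = |trig c| |φ - lam| w ≤ 2‖c‖ (‖φ‖ + |lam|) w`, whence `C`.
  -- The lowest frequency of `trigL2 c` is `-1`.
  obtain ⟨f, hf, hfk⟩ := exists_isOuter_norm_eq (k := hL2.toLp _)
    (notMem_gen_shift_of_norm_le (h := trigL2 c) (N := -1)
      (C := √(2 * ‖c‖ * (‖φ‖ + |lam|)))
      (fun n hn => fourierCoeff_trigL2_of_lt c hn) (fourierCoeff_trigL2_neg_one hc) (by
        filter_upwards [hk, trigL2_coe c, hw, hne, ae_abs_symbol_sub_le φ lam]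
          with x h1 h2 h3 h4 h5
        rw [h1, h2, Complex.norm_real, ← Real.sqrt_mul (by positivity)]
        refine Real.le_sqrt_of_sq_le ?_
        have h6 : trig c x = (φ x - lam) * (trig c x / (φ x - lam)) := by field_simp
        calc ‖trig c x‖ ^ 2 = |trig c x| * |trig c x| := by rw [Real.norm_eq_abs, sq]
          _ = |trig c x| * (|φ x - lam| * (trig c x / (φ x - lam))) := by
            congr 1
            conv_lhs => rw [h6]
            rw [abs_mul, abs_of_nonneg h3]
          _ ≤ 2 * ‖c‖ * ((‖φ‖ + |lam|) * (trig c x / (φ x - lam))) := by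
            gcongr
            exact abs_trig_le c x
          _ = _ := by ring))
  refine ⟨f, hf, ?_⟩
  filter_upwards [hfk, hk, hw, hne] with x h1 h2 h3 h4
  rw [h1, h2, Real.sq_sqrt h3, mul_div_cancel₀ _ h4]

/-! ### From eigenvectors back to integrable quotients -/

/-- From `n = 2` on, `χ ^ n g` has no coefficients at `0` and `1`, hence is orthogonal to all of `ℂ
⊕ ℂ z`. -/
theorem shift_mem_hardySub {V : Submodule ℂ L2} (hV : V ≤ lowDegree) {g : L2}
    (hg : g ∈ hardySub V) {n : ℕ} (hn : 2 ≤ n) : shift n g ∈ hardySub V := by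
  refine ⟨shift_mem_hardy n hg.1, ?_⟩
  have hle : lowDegree ≤ (Submodule.span ℂ {shift n g})ᗮ := by
    refine Submodule.span_le.2 ?_
    rintro _ (rfl | rfl)
    all_goals
      refine Submodule.mem_orthogonal_singleton_iff_inner_left.2 ?_
      rw [← fourierCoeff_eq_inner, fourierCoeff_shift]
      exact hg.1 _ (by omega)
  refine (Submodule.mem_orthogonal _ _).2 fun v hv => ?_
  exact Submodule.mem_orthogonal_singleton_iff_inner_left.1 (hle (hV hv))

theorem fourierCoeff_ofReal_neg (F : Circ → ℝ) (n : ℤ) :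
    fourierCoeff (fun x => (F x : ℂ)) (-n) = conj (fourierCoeff (fun x => (F x : ℂ)) n) := by
  rw [fourierCoeff, fourierCoeff, ← integral_conj]
  refine integral_congr_ae (Eventually.of_forall fun x => ?_)
  simp only [smul_eq_mul, map_mul, Complex.conj_ofReal, ← fourier_neg]

theorem integrable_symbol_sub_mul_norm_sq (φ : Symbol) (lam : ℝ) (g : L2) :
    Integrable (fun x => (φ x - lam) * ‖g x‖ ^ 2) arc :=
  (integrable_norm_sq g).bdd_mul
    ((Lp.aestronglyMeasurable φ).sub aestronglyMeasurable_const) (ae_abs_symbol_sub_le φ lam)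

/-- If `g` is an eigenvector, then `(φ - lam) |g|²` is a trigonometric polynomial `dχ + (dχ)^*`. -/
theorem IsNeilEigenvector.exists_eq_trig {φ : Symbol} {lam : ℝ} {g : L2}
    (h : IsNeilEigenvector φ lam g) :
    ∃ d : ℂ, ∀ᵐ x ∂arc, (φ x - lam) * ‖g x‖ ^ 2 = trig d x := by
  obtain ⟨V, hV, hg, -, horth⟩ := isNeilEigenvector_iff.1 h
  set F : Circ → ℝ := fun x => (φ x - lam) * ‖g x‖ ^ 2 with hF
  have hcoeff : ∀ n : ℕ, n ≠ 1 → fourierCoeff (fun x => (F x : ℂ)) n = 0 := by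
    intro n hn
    rw [← inner_shift_symbol_sub]
    rcases n.eq_zero_or_pos with rfl | hpos
    · rw [Nat.cast_zero, shift_zero]
      exact horth g hg
    · exact horth _ (shift_mem_hardySub hV hg (by omega))
  set d := fourierCoeff (fun x => (F x : ℂ)) 1 with hd
  have hall : ∀ n, fourierCoeff (fun x => (F x : ℂ)) n
      = fourierCoeff (fun x => (trig d x : ℂ)) n := by
    have hnat : ∀ n : ℕ, fourierCoeff (fun x => (F x : ℂ)) n
        = fourierCoeff (fun x => (trig d x : ℂ)) n := by
      intro n
      rw [fourierCoeff_trig, if_neg (by omega : ¬ (n : ℤ) = -1), add_zero]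
      by_cases hn : n = 1
      · subst hn
        rw [Nat.cast_one, if_pos rfl]
      · rw [hcoeff n hn, if_neg (by omega)]
    intro n
    obtain ⟨j, rfl | rfl⟩ := n.eq_nat_or_neg
    · exact hnat j
    · rw [fourierCoeff_ofReal_neg, fourierCoeff_ofReal_neg, hnat]
  have hFint : Integrable (fun x => (F x : ℂ)) arc :=
    (integrable_symbol_sub_mul_norm_sq φ lam g).ofReal
  have htint : Integrable (fun x => (trig (-d) x : ℂ)) arc := by
    refine Integrable.ofReal (Integrable.of_bound (C := 2 * ‖-d‖)
      (continuous_trig _).aestronglyMeasurable (Eventually.of_forall fun x => abs_trig_le _ x))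
  refine ⟨d, ?_⟩
  filter_upwards [ae_eq_zero_of_fourierCoeff_eq_zero (hFint.add htint) fun n => by
    rw [fourierCoeff.add hFint htint, Pi.add_apply, hall, fourierCoeff_trig, fourierCoeff_trig,
      map_neg]
    split_ifs <;> ring] with x hx
  have h1 : ((F x : ℝ) : ℂ) + (trig (-d) x : ℝ) = 0 := hx
  have h2 : F x + trig (-d) x = 0 := by exact_mod_cast h1
  have h3 := trig_smul (-1) d x
  rw [Complex.ofReal_neg, Complex.ofReal_one, neg_one_mul, neg_one_mul] at h3
  linarith

theorem quotientMemL1_of_isNeilEigenvalue {φ : Symbol} {lam : ℝ} {c : ℂ} (hc : c ≠ 0)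
    (hsign : ∀ᵐ x ∂arc, 0 ≤ (φ x - lam) * trig c x) (hne : ¬ ∀ᵐ x ∂arc, φ x = lam)
    (h : IsNeilEigenvalue φ lam) : QuotientMemL1 (trig c) (fun x => φ x - lam) := by
  obtain ⟨g, hg⟩ := h
  obtain ⟨d, hd⟩ := hg.exists_eq_trig
  obtain ⟨V, -, hgV, hg0, -⟩ := isNeilEigenvector_iff.1 hg
  have hgne := ae_ne_zero_of_mem_hardy hgV.1 hg0
  obtain ⟨t, ht, rfl⟩ := exists_eq_mul_of_trig_mul_nonneg hc (d := d) (by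
    filter_upwards [hd, hsign] with x h1 h2
    rw [← h1, mul_right_comm]
    positivity)
  -- If `t = 0`, then `(φ - lam) |g|² = 0` with `g ≠ 0` a.e., so `φ = lam` a.e.
  have ht0 : t ≠ 0 := by
    rintro rfl
    refine hne ?_
    filter_upwards [hd, hgne] with x h1 h2
    rw [trig_smul, zero_mul, mul_eq_zero, sub_eq_zero] at h1
    exact h1.resolve_right (pow_ne_zero 2 (norm_ne_zero_iff.2 h2))
  have hnz : ∀ᵐ x ∂arc, φ x - lam ≠ 0 := by
    filter_upwards [hd, ae_trig_ne_zero hc] with x h1 h2 h3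
    rw [h3, zero_mul, trig_smul] at h1
    exact mul_ne_zero ht0 h2 h1.symm
  refine ⟨hnz, ((integrable_norm_sq g).const_mul t⁻¹).congr ?_⟩
  filter_upwards [hd, hnz] with x h1 h2
  rw [trig_smul] at h1
  rw [eq_div_iff h2, mul_assoc, mul_comm _ (φ x - lam), h1, inv_mul_cancel_left₀ ht0]

theorem isNeilEigenvalue_iff_quotientMemL1 {φ : Symbol} {lam : ℝ} {c : ℂ} (hc : c ≠ 0)
    (hsign : ∀ᵐ x ∂arc, 0 ≤ (φ x - lam) * trig c x) (hne : ¬ ∀ᵐ x ∂arc, φ x = lam) :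
    IsNeilEigenvalue φ lam ↔ QuotientMemL1 (trig c) (fun x => φ x - lam) := by
  refine ⟨quotientMemL1_of_isNeilEigenvalue hc hsign hne, fun hq => ?_⟩
  obtain ⟨f, hf, hfe⟩ := exists_isOuter_of_quotientMemL1 hc hsign hq
  exact ⟨f, isNeilEigenvector_of_isOuter hf hfe⟩

theorem quotientMemL1_of_le_abs {φ : Symbol} {lam δ : ℝ} (c : ℂ) (hδ : 0 < δ)
    (h : ∀ᵐ x ∂arc, δ ≤ |φ x - lam|) : QuotientMemL1 (trig c) (fun x => φ x - lam) := by
  refine ⟨h.mono fun x hx => abs_pos.1 (hδ.trans_le hx), ?_⟩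
  refine Integrable.of_bound (C := 2 * ‖c‖ / δ)
    (((continuous_trig c).measurable.div
      ((Lp.stronglyMeasurable φ).measurable.sub_const lam)).aestronglyMeasurable) ?_
  filter_upwards [h] with x hx
  rw [norm_div, Real.norm_eq_abs, Real.norm_eq_abs]
  gcongr
  exact abs_trig_le c x

end NeilToeplitz

end

/-! ### The main theorem -/

theorem corollary3p2 (φ : NeilToeplitz.Symbol) (c : ℂ) (m M : ℝ)
    (hm : essSup (fun x => ((φ x : ℝ) : EReal))
      (NeilToeplitz.arc.restrict {x | NeilToeplitz.trig c x < 0}) = (m : EReal))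
    (hm0 : m < 0) (hM0 : 0 < M)
    (hM : essInf (fun x => ((φ x : ℝ) : EReal))
      (NeilToeplitz.arc.restrict {x | 0 < NeilToeplitz.trig c x}) = (M : EReal)) :
    (∀ lam ∈ Set.Ioo m M,
      NeilToeplitz.IsNeilEigenvalue φ lam ∧
      ∃ f : NeilToeplitz.L2,
        NeilToeplitz.IsOuter f ∧
        (∀ᵐ x ∂NeilToeplitz.arc, (φ x - lam) * ‖f x‖ ^ 2 = NeilToeplitz.trig c x) ∧
        NeilToeplitz.IsNeilEigenvector φ lam f ∧
        ∀ h : NeilToeplitz.L2, NeilToeplitz.IsOuter h →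
          (∀ᵐ x ∂NeilToeplitz.arc, (φ x - lam) * ‖h x‖ ^ 2 = NeilToeplitz.trig c x) →
          ∃ u : ℂ, ‖u‖ = 1 ∧ h = u • f) ∧
    (NeilToeplitz.IsNeilEigenvalue φ M ↔
      NeilToeplitz.QuotientMemL1 (NeilToeplitz.trig c) (fun x => φ x - M)) ∧
    (NeilToeplitz.IsNeilEigenvalue φ m ↔
      NeilToeplitz.QuotientMemL1 (NeilToeplitz.trig c) (fun x => φ x - m)) := by
  open NeilToeplitz in
  have hmeas := (continuous_trig c).measurable
  have hneg : ∀ᵐ x ∂arc, trig c x < 0 → φ x ≤ m := by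
    have h1 := ae_le_essSup (μ := arc.restrict {x | trig c x < 0})
      (f := fun x => ((φ x : ℝ) : EReal))
    rw [hm, ae_restrict_iff' (measurableSet_lt hmeas measurable_const)] at h1
    exact h1.mono fun x hx hlt => EReal.coe_le_coe_iff.1 (hx hlt)
  have hpos : ∀ᵐ x ∂arc, 0 < trig c x → M ≤ φ x := by
    have h1 := ae_essInf_le (μ := arc.restrict {x | 0 < trig c x})
      (f := fun x => ((φ x : ℝ) : EReal))
    rw [hM, ae_restrict_iff' (measurableSet_lt measurable_const hmeas)] at h1
    exact h1.mono fun x hx hlt => EReal.coe_le_coe_iff.1 (hx hlt)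
  -- On a null set the essential supremum would be `⊥`, not the real number `m`; likewise `⊤` for
  -- the infimum below. Hence both signs occur on sets of positive measure, and `c ≠ 0`.
  have hnegne : ¬ ∀ᵐ x ∂arc, ¬ trig c x < 0 := fun h => by
    have h0 : arc.restrict {x | trig c x < 0} = 0 := by
      rw [Measure.restrict_eq_zero]
      simpa [ae_iff] using h
    rw [h0, essSup_measure_zero] at hm
    exact EReal.bot_ne_coe _ hm
  have hposne : ¬ ∀ᵐ x ∂arc, ¬ 0 < trig c x := fun h => by
    have h0 : arc.restrict {x | 0 < trig c x} = 0 := by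
      rw [Measure.restrict_eq_zero]
      simpa [ae_iff] using h
    rw [h0, essInf_measure_zero] at hM
    exact EReal.top_ne_coe _ hM
  have hc : c ≠ 0 := by
    rintro rfl
    exact hnegne (Filter.Eventually.of_forall fun x => by simp [trig_eq])
  have hsign : ∀ lam ∈ Set.Icc m M, ∀ᵐ x ∂arc, 0 ≤ (φ x - lam) * trig c x := by
    intro lam hlam
    filter_upwards [hneg, hpos] with x h1 h2
    rcases lt_trichotomy (trig c x) 0 with h | h | h
    · exact mul_nonneg_of_nonpos_of_nonpos (by linarith [h1 h, hlam.1]) h.le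
    · rw [h, mul_zero]
    · exact mul_nonneg (by linarith [h2 h, hlam.2]) h.le
  refine ⟨fun lam hlam => ?_, ?_, ?_⟩
  · have hq : QuotientMemL1 (trig c) (fun x => φ x - lam) := by
      -- `φ` stays at distance at least `min (lam - m) (M - lam)` from `lam`.
      refine quotientMemL1_of_le_abs c (lt_min (sub_pos.2 hlam.1) (sub_pos.2 hlam.2)) ?_
      filter_upwards [hneg, hpos, ae_trig_ne_zero hc] with x h1 h2 h3
      rcases lt_or_gt_of_ne h3 with h | h
      · exact (min_le_left _ _).trans (by linarith [h1 h, neg_le_abs (φ x - lam)])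
      · exact (min_le_right _ _).trans (by linarith [h2 h, le_abs_self (φ x - lam)])
    obtain ⟨f, hf, hfe⟩ :=
      exists_isOuter_of_quotientMemL1 hc (hsign lam (Set.Ioo_subset_Icc_self hlam)) hq
    have hev := isNeilEigenvector_of_isOuter hf hfe
    refine ⟨⟨f, hev⟩, f, hf, hfe, hev, fun h hh hhe => hf.eq_smul_of_norm_eq hh ?_ ?_⟩
    · filter_upwards [hfe, ae_trig_ne_zero hc] with x h1 h2 h3
      rw [h3, norm_zero, zero_pow two_ne_zero, mul_zero] at h1
      exact h2 h1.symm
    · filter_upwards [hfe, hhe, hq.1] with x h1 h2 h3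
      exact (sq_eq_sq₀ (norm_nonneg _) (norm_nonneg _)).1 (mul_left_cancel₀ h3 (h1.trans h2.symm))
  · refine isNeilEigenvalue_iff_quotientMemL1 hc (hsign M ⟨by linarith, le_rfl⟩) fun h => hnegne ?_
    filter_upwards [h, hneg] with x h1 h2 h3
    linarith [h2 h3]
  · refine isNeilEigenvalue_iff_quotientMemL1 hc (hsign m ⟨le_rfl, by linarith⟩) fun h => hposne ?_
    filter_upwards [h, hpos] with x h1 h2 h3
    linarith [h2 h3]
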